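/- Let $R$ be a (two-sided) coherent ring, that is, an associative unital ring for which the categories of finitely presented right $R$-modules and of finitely presented left $R$-modules are abelian. Let $\mathrm{Mod}(R)$ be the category of all right $R$-modules, $\mathrm{Ab}$ the category of abelian groups, and let $F\colon \mathrm{Mod}(R)\to\mathrm{Ab}$ be an additive functor. For an additive functor $G\colon\mathrm{Mod}(R)\to\mathrm{Ab}$, the satellites $S_1G$ and $S^1G$ are the functors given on a module $X$ by $$S_1G(X)=\ker\bigl(G(\Omega X)\to G(P)\bigr),\qquad S^1G(X)=\operatorname{coker}\bigl(G(I)\to G(\Sigma X)\bigr),$$ where $0\to\Omega X\to P\to X\to 0$ and $0\to X\to I\to\Sigma X\to 0$ are exact with $P$ projective and $I$ injective; $S^1$ is left adjoint to $S_1$, so $S^2=S^1S^1$ is left adjoint to $S_2=S_1S_1$. Suppose that 1. $F$ is totally finitely presented: there are finitely presented right $R$-modules $X,Y$ and an exact sequence of functors $\operatorname{Hom}_R(Y,-)\to\operatorname{Hom}_R(X,-)\to F\to 0$; 2. $F$ is half exact: for every short exact sequence $0\to A\to B\to C\to 0$ of right $R$-modules, $F(A)\to F(B)\to F(C)$ is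 exact; 3. $F$ is horizontally linked: the counit of adjunction $S^2S_2F\to F$ is an isomorphism. Then $F$ is an extension functor: there is a (not necessarily finitely presented) right $R$-module $M$ such that $F\cong\operatorname{Ext}^1_R(M,-)$ as functors $\mathrm{Mod}(R)\to\mathrm{Ab}$. -/

import Mathlib

open CategoryTheory CategoryTheory.Limits

universe u

namespace Satellite

noncomputable section

section Conn

universe v₁ v₂ u₁ u₂

variable {C : Type u₁} [Category.{v₁} C] [Abelian C]
variable {D : Type u₂} [Category.{v₂} D] [Abelian D]

/-! ### Syzygies and cosyzygies -/

/-- The chosen cosyzygy sequence `0 ⟶ X ⟶ I ⟶ ΣX ⟶ 0`, with `I` injective. -/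
abbrev cosyz [EnoughInjectives C] (X : C) : ShortComplex C :=
  ShortComplex.mk (Injective.ι X) (cokernel.π (Injective.ι X)) (cokernel.condition _)

lemma cosyz_shortExact [EnoughInjectives C] (X : C) : (cosyz X).ShortExact where
  exact := ShortComplex.exact_cokernel _
  mono_f := by dsimp; infer_instance
  epi_g := by dsimp; infer_instance

/-- The chosen syzygy sequence `0 ⟶ ΩX ⟶ P ⟶ X ⟶ 0`, with `P` projective. -/
abbrev syz [EnoughProjectives C] (X : C) : ShortComplex C :=
  ShortComplex.mk (kernel.ι (Projective.π X)) (Projective.π X) (kernel.condition _)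

lemma syz_shortExact [EnoughProjectives C] (X : C) : (syz X).ShortExact where
  exact := ShortComplex.exact_kernel _
  mono_f := by dsimp; infer_instance
  epi_g := by dsimp; infer_instance

/-! ### The right satellite `S¹F` -/

section Right

variable [EnoughInjectives C]

/-- `S¹F(X)` is the cokernel of `F(I) ⟶ F(ΣX)`. -/
abbrev rightObj (F : C ⥤ D) (X : C) : D := cokernel (F.map (cosyz X).g)

lemma exists_conn {S : ShortComplex C} (hS : S.ShortExact) {Y : C} (a : S.X₁ ⟶ Y) :
    ∃ (s : S.X₃ ⟶ (cosyz Y).X₃) (w : S.X₂ ⟶ (cosyz Y).X₂),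
      S.f ≫ w = a ≫ (cosyz Y).f ∧ S.g ≫ s = w ≫ (cosyz Y).g := by
  have := hS.mono_f
  have := hS.epi_g
  let w : S.X₂ ⟶ (cosyz Y).X₂ := Injective.factorThru (a ≫ (cosyz Y).f) S.f
  have hw : S.f ≫ w = a ≫ (cosyz Y).f := Injective.comp_factorThru _ _
  have h0 : S.f ≫ w ≫ (cosyz Y).g = 0 := by
    rw [← Category.assoc, hw, Category.assoc, (cosyz Y).zero, comp_zero]
  exact ⟨hS.exact.desc _ h0, w, hw, hS.exact.g_desc _ h0⟩

/-- For a short exact sequence `0 ⟶ X₁ ⟶ X₂ ⟶ X₃ ⟶ 0` and a morphism `a : X₁ ⟶ Y`, the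
morphism `F(X₃) ⟶ S¹F(Y)` obtained by extending `a` to a morphism of short exact sequences
into the cosyzygy sequence of `Y`. -/
def conn (F : C ⥤ D) {S : ShortComplex C} (hS : S.ShortExact) {Y : C} (a : S.X₁ ⟶ Y) :
    F.obj S.X₃ ⟶ rightObj F Y :=
  F.map (exists_conn hS a).choose ≫ cokernel.π (F.map (cosyz Y).g)

lemma conn_eq (F : C ⥤ D) [F.Additive] {S : ShortComplex C} (hS : S.ShortExact) {Y : C}
    (a : S.X₁ ⟶ Y) (s : S.X₃ ⟶ (cosyz Y).X₃) (w : S.X₂ ⟶ (cosyz Y).X₂)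
    (hw : S.f ≫ w = a ≫ (cosyz Y).f) (hs : S.g ≫ s = w ≫ (cosyz Y).g) :
    conn F hS a = F.map s ≫ cokernel.π (F.map (cosyz Y).g) := by
  obtain ⟨w', hw', hs'⟩ := (exists_conn hS a).choose_spec
  have := hS.mono_f
  have := hS.epi_g
  have h0 : S.f ≫ (w' - w) = 0 := by rw [Preadditive.comp_sub, hw, hw', sub_self]
  have h1 : (exists_conn hS a).choose = s + hS.exact.desc _ h0 ≫ (cosyz Y).g := by
    rw [← cancel_epi S.g, Preadditive.comp_add, ← Category.assoc S.g, hS.exact.g_desc _ h0, hs',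
      hs, Preadditive.sub_comp]
    abel
  rw [conn, h1, F.map_add, Preadditive.add_comp, F.map_comp, Category.assoc, cokernel.condition,
    comp_zero, add_zero]

lemma conn_precomp (F : C ⥤ D) [F.Additive] {S T : ShortComplex C} (hS : S.ShortExact)
    (hT : T.ShortExact) {Y : C} (t₁ : S.X₁ ⟶ T.X₁) (t₂ : S.X₂ ⟶ T.X₂) (t₃ : S.X₃ ⟶ T.X₃)
    (h₁ : S.f ≫ t₂ = t₁ ≫ T.f) (h₂ : S.g ≫ t₃ = t₂ ≫ T.g) (a : T.X₁ ⟶ Y) :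
    F.map t₃ ≫ conn F hT a = conn F hS (t₁ ≫ a) := by
  obtain ⟨s, w, hw, hs⟩ := exists_conn hT a
  rw [conn_eq F hT a s w hw hs, conn_eq F hS (t₁ ≫ a) (t₃ ≫ s) (t₂ ≫ w), F.map_comp,
    Category.assoc]
  · rw [← Category.assoc, h₁, Category.assoc, hw, Category.assoc]
  · rw [← Category.assoc, h₂, Category.assoc, hs, Category.assoc]

lemma map_g_conn (F : C ⥤ D) [F.Additive] {S : ShortComplex C} (hS : S.ShortExact) {Y : C}
    (a : S.X₁ ⟶ Y) : F.map S.g ≫ conn F hS a = 0 := by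
  obtain ⟨s, w, hw, hs⟩ := exists_conn hS a
  rw [conn_eq F hS a s w hw hs, ← Category.assoc, ← F.map_comp, hs, F.map_comp, Category.assoc,
    cokernel.condition, comp_zero]

lemma conn_cosyz_id (F : C ⥤ D) [F.Additive] (X : C) :
    conn F (cosyz_shortExact X) (𝟙 X) = cokernel.π (F.map (cosyz X).g) := by
  rw [conn_eq F (cosyz_shortExact X) (𝟙 X) (𝟙 _) (𝟙 _) (by simp) (by simp), F.map_id,
    Category.id_comp]

lemma conn_f (F : C ⥤ D) [F.Additive] {S : ShortComplex C} (hS : S.ShortExact) :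
    conn F hS S.f = 0 := by
  rw [conn_eq F hS S.f 0 (cosyz S.X₂).f rfl (by rw [(cosyz S.X₂).zero, comp_zero]), F.map_zero,
    zero_comp]

lemma conn_add (F : C ⥤ D) [F.Additive] {S : ShortComplex C} (hS : S.ShortExact) {Y : C}
    (a b : S.X₁ ⟶ Y) : conn F hS (a + b) = conn F hS a + conn F hS b := by
  obtain ⟨s, w, hw, hs⟩ := exists_conn hS a
  obtain ⟨s', w', hw', hs'⟩ := exists_conn hS b
  rw [conn_eq F hS a s w hw hs, conn_eq F hS b s' w' hw' hs',
    conn_eq F hS (a + b) (s + s') (w + w') (by simp [hw, hw']) (by simp [hs, hs']), F.map_add,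
    Preadditive.add_comp]

/-- The action of `S¹F` on morphisms. -/
def rightMap (F : C ⥤ D) [F.Additive] {X Y : C} (f : X ⟶ Y) : rightObj F X ⟶ rightObj F Y :=
  cokernel.desc _ (conn F (cosyz_shortExact X) f) (map_g_conn F (cosyz_shortExact X) f)

lemma π_rightMap (F : C ⥤ D) [F.Additive] {X Y : C} (f : X ⟶ Y) :
    cokernel.π (F.map (cosyz X).g) ≫ rightMap F f = conn F (cosyz_shortExact X) f :=
  cokernel.π_desc _ _ _

lemma conn_rightMap (F : C ⥤ D) [F.Additive] {S : ShortComplex C} (hS : S.ShortExact) {X Y : C}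
    (a : S.X₁ ⟶ X) (f : X ⟶ Y) : conn F hS a ≫ rightMap F f = conn F hS (a ≫ f) := by
  obtain ⟨s, w, hw, hs⟩ := exists_conn hS a
  rw [conn_eq F hS a s w hw hs, Category.assoc, π_rightMap]
  exact conn_precomp F hS (cosyz_shortExact X) a w s hw hs f

/-- The right satellite `S¹F` of an additive functor `F`. -/
abbrev rightFunctor (F : C ⥤ D) [F.Additive] : C ⥤ D where
  obj X := rightObj F X
  map f := rightMap F f
  map_id X := by
    rw [← cancel_epi (cokernel.π (F.map (cosyz X).g)), π_rightMap, Category.comp_id]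
    exact conn_cosyz_id F X
  map_comp {X Y Z} f g := by
    rw [← cancel_epi (cokernel.π (F.map (cosyz X).g)), π_rightMap, ← Category.assoc, π_rightMap]
    exact (conn_rightMap F (cosyz_shortExact X) f g).symm

instance (F : C ⥤ D) [F.Additive] : (rightFunctor F).Additive where
  map_add {X Y f g} := by
    change rightMap F (f + g) = rightMap F f + rightMap F g
    rw [← cancel_epi (cokernel.π (F.map (cosyz X).g)), Preadditive.comp_add, π_rightMap,
      π_rightMap, π_rightMap]
    exact conn_add F (cosyz_shortExact X) f g

/-- The components of `S¹α : S¹F ⟶ S¹G`, for `α : F ⟶ G`. -/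
def rightNatApp {F G : C ⥤ D} (α : F ⟶ G) (X : C) : rightObj F X ⟶ rightObj G X :=
  cokernel.map _ _ (α.app _) (α.app _) (α.naturality _)

lemma π_rightNatApp {F G : C ⥤ D} (α : F ⟶ G) (X : C) :
    cokernel.π (F.map (cosyz X).g) ≫ rightNatApp α X =
      α.app _ ≫ cokernel.π (G.map (cosyz X).g) :=
  cokernel.π_desc _ _ _

lemma conn_rightNatApp {F G : C ⥤ D} [F.Additive] [G.Additive] (α : F ⟶ G)
    {S : ShortComplex C} (hS : S.ShortExact) {Y : C} (a : S.X₁ ⟶ Y) :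
    conn F hS a ≫ rightNatApp α Y = α.app S.X₃ ≫ conn G hS a := by
  obtain ⟨s, w, hw, hs⟩ := exists_conn hS a
  rw [conn_eq F hS a s w hw hs, conn_eq G hS a s w hw hs, Category.assoc, π_rightNatApp,
    α.naturality_assoc]

/-- The natural transformation `S¹α : S¹F ⟶ S¹G` induced by `α : F ⟶ G`. -/
def rightNat {F G : C ⥤ D} [F.Additive] [G.Additive] (α : F ⟶ G) :
    rightFunctor F ⟶ rightFunctor G where
  app X := rightNatApp α X
  naturality X Y f := by
    change rightMap F f ≫ rightNatApp α Y = rightNatApp α X ≫ rightMap G f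
    rw [← cancel_epi (cokernel.π (F.map (cosyz X).g)), ← Category.assoc, π_rightMap,
      ← Category.assoc, π_rightNatApp, Category.assoc, π_rightMap]
    exact conn_rightNatApp α (cosyz_shortExact X) f

end Right

/-! ### The left satellite `S₁F` -/

section Left

variable [EnoughProjectives C]

/-- `S₁F(X)` is the kernel of `F(ΩX) ⟶ F(P)`. -/
abbrev leftObj (F : C ⥤ D) (X : C) : D := kernel (F.map (syz X).f)

lemma exists_coconn {S : ShortComplex C} (hS : S.ShortExact) {Y : C} (a : Y ⟶ S.X₃) :
    ∃ (s : (syz Y).X₁ ⟶ S.X₁) (w : (syz Y).X₂ ⟶ S.X₂),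
      w ≫ S.g = (syz Y).g ≫ a ∧ s ≫ S.f = (syz Y).f ≫ w := by
  have := hS.mono_f
  have := hS.epi_g
  let w : (syz Y).X₂ ⟶ S.X₂ := Projective.factorThru ((syz Y).g ≫ a) S.g
  have hw : w ≫ S.g = (syz Y).g ≫ a := Projective.factorThru_comp _ _
  have h0 : ((syz Y).f ≫ w) ≫ S.g = 0 := by
    rw [Category.assoc, hw, ← Category.assoc, (syz Y).zero, zero_comp]
  exact ⟨hS.exact.lift _ h0, w, hw, hS.exact.lift_f _ h0⟩

/-- For a short exact sequence `0 ⟶ X₁ ⟶ X₂ ⟶ X₃ ⟶ 0` and a morphism `a : Y ⟶ X₃`, the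
morphism `S₁F(Y) ⟶ F(X₁)` obtained by lifting `a` to a morphism of short exact sequences
from the syzygy sequence of `Y`. -/
def coconn (F : C ⥤ D) {S : ShortComplex C} (hS : S.ShortExact) {Y : C} (a : Y ⟶ S.X₃) :
    leftObj F Y ⟶ F.obj S.X₁ :=
  kernel.ι (F.map (syz Y).f) ≫ F.map (exists_coconn hS a).choose

lemma coconn_eq (F : C ⥤ D) [F.Additive] {S : ShortComplex C} (hS : S.ShortExact) {Y : C}
    (a : Y ⟶ S.X₃) (s : (syz Y).X₁ ⟶ S.X₁) (w : (syz Y).X₂ ⟶ S.X₂)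
    (hw : w ≫ S.g = (syz Y).g ≫ a) (hs : s ≫ S.f = (syz Y).f ≫ w) :
    coconn F hS a = kernel.ι (F.map (syz Y).f) ≫ F.map s := by
  obtain ⟨w', hw', hs'⟩ := (exists_coconn hS a).choose_spec
  have := hS.mono_f
  have := hS.epi_g
  have h0 : (w' - w) ≫ S.g = 0 := by rw [Preadditive.sub_comp, hw, hw', sub_self]
  have h1 : (exists_coconn hS a).choose = s + (syz Y).f ≫ hS.exact.lift _ h0 := by
    rw [← cancel_mono S.f, Preadditive.add_comp, Category.assoc, hS.exact.lift_f _ h0, hs',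
      hs, Preadditive.comp_sub]
    abel
  rw [coconn, h1, F.map_add, Preadditive.comp_add, F.map_comp, ← Category.assoc,
    kernel.condition, zero_comp, add_zero]

lemma coconn_postcomp (F : C ⥤ D) [F.Additive] {S T : ShortComplex C} (hS : S.ShortExact)
    (hT : T.ShortExact) {Y : C} (t₁ : S.X₁ ⟶ T.X₁) (t₂ : S.X₂ ⟶ T.X₂) (t₃ : S.X₃ ⟶ T.X₃)
    (h₁ : S.f ≫ t₂ = t₁ ≫ T.f) (h₂ : S.g ≫ t₃ = t₂ ≫ T.g) (a : Y ⟶ S.X₃) :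
    coconn F hS a ≫ F.map t₁ = coconn F hT (a ≫ t₃) := by
  obtain ⟨s, w, hw, hs⟩ := exists_coconn hS a
  rw [coconn_eq F hS a s w hw hs, coconn_eq F hT (a ≫ t₃) (s ≫ t₁) (w ≫ t₂), F.map_comp,
    Category.assoc]
  · rw [Category.assoc, ← h₂, ← Category.assoc, hw, Category.assoc]
  · rw [Category.assoc, ← h₁, ← Category.assoc, hs, Category.assoc]

lemma coconn_map_f (F : C ⥤ D) [F.Additive] {S : ShortComplex C} (hS : S.ShortExact) {Y : C}
    (a : Y ⟶ S.X₃) : coconn F hS a ≫ F.map S.f = 0 := by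
  obtain ⟨s, w, hw, hs⟩ := exists_coconn hS a
  rw [coconn_eq F hS a s w hw hs, Category.assoc, ← F.map_comp, hs, F.map_comp, ← Category.assoc,
    kernel.condition, zero_comp]

lemma coconn_syz_id (F : C ⥤ D) [F.Additive] (X : C) :
    coconn F (syz_shortExact X) (𝟙 X) = kernel.ι (F.map (syz X).f) := by
  rw [coconn_eq F (syz_shortExact X) (𝟙 X) (𝟙 _) (𝟙 _) (by simp) (by simp), F.map_id,
    Category.comp_id]

lemma coconn_g (F : C ⥤ D) [F.Additive] {S : ShortComplex C} (hS : S.ShortExact) :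
    coconn F hS S.g = 0 := by
  rw [coconn_eq F hS S.g 0 (syz S.X₂).g rfl (by rw [(syz S.X₂).zero, zero_comp]), F.map_zero,
    comp_zero]

lemma coconn_add (F : C ⥤ D) [F.Additive] {S : ShortComplex C} (hS : S.ShortExact) {Y : C}
    (a b : Y ⟶ S.X₃) : coconn F hS (a + b) = coconn F hS a + coconn F hS b := by
  obtain ⟨s, w, hw, hs⟩ := exists_coconn hS a
  obtain ⟨s', w', hw', hs'⟩ := exists_coconn hS b
  rw [coconn_eq F hS a s w hw hs, coconn_eq F hS b s' w' hw' hs',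
    coconn_eq F hS (a + b) (s + s') (w + w') (by simp [hw, hw']) (by simp [hs, hs']), F.map_add,
    Preadditive.comp_add]

/-- The action of `S₁F` on morphisms. -/
def leftMap (F : C ⥤ D) [F.Additive] {X Y : C} (f : X ⟶ Y) : leftObj F X ⟶ leftObj F Y :=
  kernel.lift _ (coconn F (syz_shortExact Y) f) (coconn_map_f F (syz_shortExact Y) f)

lemma leftMap_ι (F : C ⥤ D) [F.Additive] {X Y : C} (f : X ⟶ Y) :
    leftMap F f ≫ kernel.ι (F.map (syz Y).f) = coconn F (syz_shortExact Y) f :=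
  kernel.lift_ι _ _ _

lemma leftMap_coconn (F : C ⥤ D) [F.Additive] {S : ShortComplex C} (hS : S.ShortExact) {X Y : C}
    (f : X ⟶ Y) (a : Y ⟶ S.X₃) : leftMap F f ≫ coconn F hS a = coconn F hS (f ≫ a) := by
  obtain ⟨s, w, hw, hs⟩ := exists_coconn hS a
  rw [coconn_eq F hS a s w hw hs, ← Category.assoc, leftMap_ι]
  exact coconn_postcomp F (syz_shortExact Y) hS s w a hs.symm hw.symm f

/-- The left satellite `S₁F` of an additive functor `F`. -/
abbrev leftFunctor (F : C ⥤ D) [F.Additive] : C ⥤ D where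
  obj X := leftObj F X
  map f := leftMap F f
  map_id X := by
    rw [← cancel_mono (kernel.ι (F.map (syz X).f)), leftMap_ι, Category.id_comp]
    exact coconn_syz_id F X
  map_comp {X Y Z} f g := by
    rw [← cancel_mono (kernel.ι (F.map (syz Z).f)), leftMap_ι, Category.assoc, leftMap_ι]
    exact (leftMap_coconn F (syz_shortExact Z) f g).symm

instance (F : C ⥤ D) [F.Additive] : (leftFunctor F).Additive where
  map_add {X Y f g} := by
    change leftMap F (f + g) = leftMap F f + leftMap F g
    rw [← cancel_mono (kernel.ι (F.map (syz Y).f)), Preadditive.add_comp, leftMap_ι, leftMap_ι,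
      leftMap_ι]
    exact coconn_add F (syz_shortExact Y) f g

/-- The components of `S₁α : S₁F ⟶ S₁G`, for `α : F ⟶ G`. -/
def leftNatApp {F G : C ⥤ D} (α : F ⟶ G) (X : C) : leftObj F X ⟶ leftObj G X :=
  kernel.map _ _ (α.app _) (α.app _) (α.naturality _)

lemma leftNatApp_ι {F G : C ⥤ D} (α : F ⟶ G) (X : C) :
    leftNatApp α X ≫ kernel.ι (G.map (syz X).f) =
      kernel.ι (F.map (syz X).f) ≫ α.app _ :=
  kernel.lift_ι _ _ _

lemma leftNatApp_coconn {F G : C ⥤ D} [F.Additive] [G.Additive] (α : F ⟶ G)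
    {S : ShortComplex C} (hS : S.ShortExact) {Y : C} (a : Y ⟶ S.X₃) :
    leftNatApp α Y ≫ coconn G hS a = coconn F hS a ≫ α.app S.X₁ := by
  obtain ⟨s, w, hw, hs⟩ := exists_coconn hS a
  rw [coconn_eq F hS a s w hw hs, coconn_eq G hS a s w hw hs, ← Category.assoc, leftNatApp_ι,
    Category.assoc, Category.assoc, α.naturality]

/-- The natural transformation `S₁α : S₁F ⟶ S₁G` induced by `α : F ⟶ G`. -/
def leftNat {F G : C ⥤ D} [F.Additive] [G.Additive] (α : F ⟶ G) :
    leftFunctor F ⟶ leftFunctor G where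
  app X := leftNatApp α X
  naturality X Y f := by
    change leftMap F f ≫ leftNatApp α Y = leftNatApp α X ≫ leftMap G f
    rw [← cancel_mono (kernel.ι (G.map (syz Y).f)), Category.assoc, leftNatApp_ι,
      ← Category.assoc, leftMap_ι, Category.assoc, leftMap_ι]
    exact (leftNatApp_coconn α (syz_shortExact Y) f).symm

end Left

/-! ### The adjunction between the satellites -/

section Adj

variable [EnoughInjectives C] [EnoughProjectives C]

/-- A natural transformation `α : S¹F ⟶ G` induces `F ⟶ S₁G`, whose component at `X` is
induced by `F(X) ⟶ S¹F(ΩX) ⟶ G(ΩX)`. -/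
def toLeft {F G : C ⥤ D} [F.Additive] [G.Additive] (α : rightFunctor F ⟶ G) :
    F ⟶ leftFunctor G where
  app X := kernel.lift (G.map (syz X).f)
    (conn F (syz_shortExact X) (𝟙 _) ≫ α.app (syz X).X₁) (by
      have h : α.app (syz X).X₁ ≫ G.map (syz X).f = rightMap F (syz X).f ≫ α.app (syz X).X₂ :=
        (α.naturality (syz X).f).symm
      rw [Category.assoc, h, ← Category.assoc, conn_rightMap, Category.id_comp, conn_f,
        zero_comp])
  naturality X Y f := by
    change _ = _ ≫ leftMap G f
    obtain ⟨s, w, hw, hs⟩ := exists_coconn (syz_shortExact Y) f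
    have h : α.app (syz X).X₁ ≫ G.map s = rightMap F s ≫ α.app (syz Y).X₁ :=
      (α.naturality s).symm
    rw [← cancel_mono (kernel.ι (G.map (syz Y).f)), Category.assoc, kernel.lift_ι,
      Category.assoc, leftMap_ι, coconn_eq G (syz_shortExact Y) f s w hw hs,
      kernel.lift_ι_assoc, Category.assoc, h, ← Category.assoc (conn F _ _), conn_rightMap,
      ← Category.assoc, conn_precomp F (syz_shortExact X) (syz_shortExact Y) s w f hs.symm
      hw.symm, Category.comp_id, Category.id_comp]

lemma toLeft_app_ι {F G : C ⥤ D} [F.Additive] [G.Additive] (α : rightFunctor F ⟶ G) (X : C) :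
    (toLeft α).app X ≫ kernel.ι (G.map (syz X).f) =
      conn F (syz_shortExact X) (𝟙 _) ≫ α.app (syz X).X₁ :=
  kernel.lift_ι _ _ _

/-- A natural transformation `β : F ⟶ S₁G` induces `S¹F ⟶ G`, whose component at `X` is
induced by `F(ΣX) ⟶ S₁G(ΣX) ⟶ G(X)`. -/
def toRight {F G : C ⥤ D} [F.Additive] [G.Additive] (β : F ⟶ leftFunctor G) :
    rightFunctor F ⟶ G where
  app X := cokernel.desc (F.map (cosyz X).g)
    (β.app (cosyz X).X₃ ≫ coconn G (cosyz_shortExact X) (𝟙 _)) (by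
      have h : F.map (cosyz X).g ≫ β.app (cosyz X).X₃ =
        β.app (cosyz X).X₂ ≫ leftMap G (cosyz X).g := β.naturality (cosyz X).g
      rw [← Category.assoc, h, Category.assoc, leftMap_coconn, Category.comp_id, coconn_g,
        comp_zero])
  naturality X Y f := by
    change rightMap F f ≫ _ = _
    obtain ⟨s, w, hw, hs⟩ := exists_conn (cosyz_shortExact X) f
    have h : F.map s ≫ β.app (cosyz Y).X₃ = β.app (cosyz X).X₃ ≫ leftMap G s :=
      β.naturality s
    rw [← cancel_epi (cokernel.π (F.map (cosyz X).g)), ← Category.assoc, π_rightMap,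
      cokernel.π_desc_assoc, conn_eq F (cosyz_shortExact X) f s w hw hs, Category.assoc,
      cokernel.π_desc, ← Category.assoc, h, Category.assoc, leftMap_coconn, Category.assoc,
      coconn_postcomp G (cosyz_shortExact X) (cosyz_shortExact Y) f w s hw hs,
      Category.comp_id, Category.id_comp]

lemma π_toRight_app {F G : C ⥤ D} [F.Additive] [G.Additive] (β : F ⟶ leftFunctor G) (X : C) :
    cokernel.π (F.map (cosyz X).g) ≫ (toRight β).app X =
      β.app (cosyz X).X₃ ≫ coconn G (cosyz_shortExact X) (𝟙 _) :=
  cokernel.π_desc _ _ _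

lemma toLeft_app_coconn {F G : C ⥤ D} [F.Additive] [G.Additive] (α : rightFunctor F ⟶ G)
    {S : ShortComplex C} (hS : S.ShortExact) :
    (toLeft α).app S.X₃ ≫ coconn G hS (𝟙 _) = conn F hS (𝟙 _) ≫ α.app S.X₁ := by
  obtain ⟨s, w, hw, hs⟩ := exists_coconn hS (𝟙 S.X₃)
  have h : α.app (syz S.X₃).X₁ ≫ G.map s = rightMap F s ≫ α.app S.X₁ := (α.naturality s).symm
  have h' := conn_precomp F (syz_shortExact S.X₃) hS s w (𝟙 _) hs.symm hw.symm (𝟙 _)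
  rw [F.map_id, Category.id_comp, Category.comp_id] at h'
  rw [coconn_eq G hS (𝟙 _) s w hw hs, ← Category.assoc, toLeft_app_ι, Category.assoc, h,
    ← Category.assoc, conn_rightMap, Category.id_comp, h']

lemma conn_toRight_app {F G : C ⥤ D} [F.Additive] [G.Additive] (β : F ⟶ leftFunctor G)
    {S : ShortComplex C} (hS : S.ShortExact) :
    conn F hS (𝟙 _) ≫ (toRight β).app S.X₁ = β.app S.X₃ ≫ coconn G hS (𝟙 _) := by
  obtain ⟨s, w, hw, hs⟩ := exists_conn hS (𝟙 S.X₁)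
  have h : F.map s ≫ β.app (cosyz S.X₁).X₃ = β.app S.X₃ ≫ leftMap G s := β.naturality s
  have h' := coconn_postcomp G hS (cosyz_shortExact S.X₁) (𝟙 _) w s hw hs (𝟙 _)
  rw [G.map_id, Category.comp_id, Category.id_comp] at h'
  rw [conn_eq F hS (𝟙 _) s w hw hs, Category.assoc, π_toRight_app, ← Category.assoc, h,
    Category.assoc, leftMap_coconn, Category.comp_id, h']

lemma toRight_comp {F' F G : C ⥤ D} [F'.Additive] [F.Additive] [G.Additive] (φ : F' ⟶ F)
    (β : F ⟶ leftFunctor G) : toRight (φ ≫ β) = rightNat φ ≫ toRight β := by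
  refine NatTrans.ext (funext fun X => ?_)
  change (toRight (φ ≫ β)).app X = rightNatApp φ X ≫ (toRight β).app X
  rw [← cancel_epi (cokernel.π (F'.map (cosyz X).g)), π_toRight_app, ← Category.assoc,
    π_rightNatApp, Category.assoc, π_toRight_app]
  exact Category.assoc _ _ _

lemma toLeft_comp {F G G' : C ⥤ D} [F.Additive] [G.Additive] [G'.Additive]
    (α : rightFunctor F ⟶ G) (ψ : G ⟶ G') : toLeft (α ≫ ψ) = toLeft α ≫ leftNat ψ := by
  refine NatTrans.ext (funext fun X => ?_)
  change (toLeft (α ≫ ψ)).app X = (toLeft α).app X ≫ leftNatApp ψ X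
  rw [← cancel_mono (kernel.ι (G'.map (syz X).f)), toLeft_app_ι, Category.assoc,
    leftNatApp_ι, ← Category.assoc, toLeft_app_ι]
  exact (Category.assoc _ _ _).symm

/-- The bijection `Nat(S¹F, G) ≃ Nat(F, S₁G)`. -/
def natEquiv (F G : C ⥤ D) [F.Additive] [G.Additive] :
    (rightFunctor F ⟶ G) ≃ (F ⟶ leftFunctor G) where
  toFun := toLeft
  invFun := toRight
  left_inv α := by
    refine NatTrans.ext (funext fun X => ?_)
    have h := toLeft_app_coconn α (cosyz_shortExact X)
    rw [← π_toRight_app] at h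
    rw [← cancel_epi (cokernel.π (F.map (cosyz X).g)), h]
    exact congrArg (· ≫ α.app X) (conn_cosyz_id F X)
  right_inv β := by
    refine NatTrans.ext (funext fun X => ?_)
    have h := conn_toRight_app β (syz_shortExact X)
    rw [← toLeft_app_ι] at h
    rw [← cancel_mono (kernel.ι (G.map (syz X).f)), h]
    exact congrArg (β.app X ≫ ·) (coconn_syz_id G X)

variable (C D)

/-- The right satellite `S¹` as an endofunctor of the category of additive functors. -/
abbrev right : (C ⥤+ D) ⥤ (C ⥤+ D) where
  obj F := AdditiveFunctor.of (rightFunctor F.obj)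
  map α := ObjectProperty.homMk (rightNat α.hom)
  map_id F := by
    ext X
    change rightNatApp (𝟙 F.obj) X = 𝟙 _
    rw [← cancel_epi (cokernel.π (F.obj.map (cosyz X).g)), π_rightNatApp, Category.comp_id]
    exact Category.id_comp _
  map_comp {F G H} α β := by
    ext X
    change rightNatApp (α.hom ≫ β.hom) X = rightNatApp α.hom X ≫ rightNatApp β.hom X
    rw [← cancel_epi (cokernel.π (F.obj.map (cosyz X).g)), π_rightNatApp, ← Category.assoc,
      π_rightNatApp, Category.assoc, π_rightNatApp]
    exact Category.assoc _ _ _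

/-- The left satellite `S₁` as an endofunctor of the category of additive functors. -/
abbrev left : (C ⥤+ D) ⥤ (C ⥤+ D) where
  obj F := AdditiveFunctor.of (leftFunctor F.obj)
  map α := ObjectProperty.homMk (leftNat α.hom)
  map_id F := by
    ext X
    change leftNatApp (𝟙 F.obj) X = 𝟙 _
    rw [← cancel_mono (kernel.ι (F.obj.map (syz X).f)), leftNatApp_ι, Category.id_comp]
    exact Category.comp_id _
  map_comp {F G H} α β := by
    ext X
    change leftNatApp (α.hom ≫ β.hom) X = leftNatApp α.hom X ≫ leftNatApp β.hom X
    rw [← cancel_mono (kernel.ι (H.obj.map (syz X).f)), leftNatApp_ι, Category.assoc,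
      leftNatApp_ι, ← Category.assoc, leftNatApp_ι]
    exact (Category.assoc _ _ _).symm

/-- The adjunction `S¹ ⊣ S₁`. -/
def adj : right C D ⊣ left C D :=
  Adjunction.mkOfHomEquiv
    { homEquiv := fun F G =>
        { toFun := fun α => ObjectProperty.homMk (natEquiv F.obj G.obj α.hom)
          invFun := fun β => ObjectProperty.homMk ((natEquiv F.obj G.obj).symm β.hom)
          left_inv := fun α => by
            ext1
            exact (natEquiv F.obj G.obj).left_inv α.hom
          right_inv := fun β => by
            ext1
            exact (natEquiv F.obj G.obj).right_inv β.hom }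
      homEquiv_naturality_left_symm := fun {F' F G} φ β => by
        exact InducedCategory.hom_ext (toRight_comp φ.hom β.hom)
      homEquiv_naturality_right := fun {F G G'} α ψ => by
        exact InducedCategory.hom_ext (toLeft_comp α.hom ψ.hom) }

/-- The adjunction `S² ⊣ S₂`, where `S² = S¹S¹` and `S₂ = S₁S₁`. -/
def adj₂ : right C D ⋙ right C D ⊣ left C D ⋙ left C D :=
  (adj C D).comp (adj C D)

variable {C D}

/-- `F` is horizontally linked if the counit `S²S₂F ⟶ F` is an isomorphism. -/
def IsHorizontallyLinked (F : C ⥤+ D) : Prop :=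
  IsIso ((adj₂ C D).counit.app F)

end Adj

/-- `F` is half exact if `F(A) ⟶ F(B) ⟶ F(C)` is exact for every short exact sequence
`0 ⟶ A ⟶ B ⟶ C ⟶ 0`. -/
def IsHalfExact (F : C ⥤+ D) : Prop :=
  ∀ S : ShortComplex C, S.ShortExact → (S.map F.obj).Exact

end Conn

/-! ### Modules -/

/-- The property of being a finitely presented module. -/
def isFP (A : Type u) [Ring A] : ObjectProperty (ModuleCat.{u} A) :=
  fun M => Module.FinitePresentation A M

/-- `R` is (two-sided) coherent if the categories of finitely presented right modules and of
finitely presented left modules are abelian. -/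
def IsCoherent (R : Type u) [Ring R] : Prop :=
  Nonempty (Abelian (isFP Rᵐᵒᵖ).FullSubcategory) ∧ Nonempty (Abelian (isFP R).FullSubcategory)

/-- `F` is totally finitely presented if it is isomorphic to the cokernel of some
`(Y, -) ⟶ (X, -)` with `X` and `Y` finitely presented modules. -/
def IsTotallyFinitelyPresented {A : Type u} [Ring A]
    (F : ModuleCat.{u} A ⥤+ AddCommGrpCat.{u}) : Prop :=
  ∃ (X Y : ModuleCat.{u} A) (α : preadditiveCoyoneda.obj (Opposite.op Y) ⟶
      preadditiveCoyoneda.obj (Opposite.op X)),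
    isFP A X ∧ isFP A Y ∧ Nonempty (F.obj ≅ cokernel α)

/-- `F` is an extension functor if it is isomorphic to `Ext¹(X, -)` for some module `X`. -/
def IsExtensionFunctor {A : Type u} [Ring A]
    (F : ModuleCat.{u} A ⥤+ AddCommGrpCat.{u}) : Prop :=
  ∃ X : ModuleCat.{u} A, Nonempty (F.obj ≅ Abelian.extFunctorObj X 1)

end

end Satellite

/-! A horizontally linked functor is a right satellite, hence vanishes on injectives. Present `F` by
`f : X ⟶ Y`. Since `F` kills an injective containing `X`, the embedding of `X` factors through `f`,
so `f` is mono with cokernel `Z`. Thus `F` is the subfunctor of `Ext¹(Z, -)` generated by the class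
`η` of `0 ⟶ X ⟶ Y ⟶ Z ⟶ 0`.

Half exactness makes this subfunctor a direct summand. Applied to `0 ⟶ ΩZ ⟶ X ⊞ P ⟶ Y ⟶ 0`, it gives
a morphism from the presenting sequence to the syzygy sequence of `Z`
(`exists_syzygy_endomorphism`). The induced `a : Z ⟶ Z` acts on `Ext¹(Z, -)` with image in `F` and
fixes `F` pointwise, so `a` is idempotent modulo projectives.

Such an idempotent splits stably, by an Eilenberg swindle on a countable copower
(`exists_stable_splitting`). The object `M` that splits it satisfies `F ≅ Ext¹(M, -)`; it need not
be finitely presented, because the copower is infinite. -/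

namespace Satellite

open Abelian

/-! ### Splitting idempotents modulo projectives. -/

section StableIdempotents

universe w v' u'

variable {C : Type u'} [Category.{v'} C]

section ExtOne

variable [Abelian C] [HasExt.{w} C]

/-- A morphism `f : X ⟶ Y` is `Ext¹`-null if it induces zero on `Ext¹(-, W)` for all `W`. -/
def ExtNull {X Y : C} (f : X ⟶ Y) : Prop :=
  ∀ ⦃W : C⦄ (ξ : Ext Y W 1), (Ext.mk₀ f).comp ξ (zero_add 1) = 0

lemma ExtNull.add {X Y : C} {f g : X ⟶ Y} (hf : ExtNull f) (hg : ExtNull g) :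
    ExtNull (f + g) := fun W ξ => by
  rw [Ext.mk₀_add, Ext.add_comp, hf ξ, hg ξ, add_zero]

lemma ExtNull.sub {X Y : C} {f g : X ⟶ Y} (hf : ExtNull f) (hg : ExtNull g) :
    ExtNull (f - g) := fun W ξ => by
  rw [sub_eq_add_neg, Ext.mk₀_add, Ext.mk₀_neg, Ext.add_comp, Ext.neg_comp, hf ξ, hg ξ, neg_zero,
    add_zero]

lemma ExtNull.comp_left {X Y Z : C} (f : X ⟶ Y) {g : Y ⟶ Z} (hg : ExtNull g) :
    ExtNull (f ≫ g) := fun W ξ => by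
  rw [← Ext.mk₀_comp_mk₀_assoc, hg ξ, Ext.comp_zero]

lemma ExtNull.comp_right {X Y Z : C} {f : X ⟶ Y} (hf : ExtNull f) (g : Y ⟶ Z) :
    ExtNull (f ≫ g) := fun W ξ => by
  rw [← Ext.mk₀_comp_mk₀_assoc, hf]

/-- With closure under sums and composition, this makes every morphism through a projective
invisible to `Ext¹`, so stable identities can be used as equalities there. -/
lemma extNull_of_projective {X P : C} [Projective P] (f : X ⟶ P) : ExtNull f := fun W ξ => by
  rw [Ext.eq_zero_of_projective ξ, Ext.comp_zero]

lemma ExtNull.comp_eq {X Y : C} {f g : X ⟶ Y} (h : ExtNull (f - g)) {W : C} (ξ : Ext Y W 1) :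
    (Ext.mk₀ f).comp ξ (zero_add 1) = (Ext.mk₀ g).comp ξ (zero_add 1) := by
  have := h ξ
  rwa [sub_eq_add_neg, Ext.mk₀_add, Ext.mk₀_neg, Ext.add_comp, Ext.neg_comp, ← sub_eq_add_neg,
    sub_eq_zero] at this

end ExtOne

/-- If `u ≫ v` is the identity up to a morphism that factors through an object `Q`, then
`𝟙 - v ≫ u` is, up to such morphisms, the idempotent of a direct summand. -/
lemma exists_complement [Abelian C] {X Q : C} (u v : X ⟶ X) (g : X ⟶ Q) (h : Q ⟶ X)
    (H : u ≫ v + g ≫ h = 𝟙 X) :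
    ∃ (M : C) (k : X ⟶ M) (j : M ⟶ X) (m : M ⟶ Q) (n : Q ⟶ M),
      k ≫ j = 𝟙 X - v ≫ u ∧ j ≫ k - 𝟙 M = m ≫ n := by
  -- Adding `Q` turns the approximate retraction into an exact one, `d ≫ c = 𝟙`; the complement
  -- sought is `kernel c`, the image of the idempotent `𝟙 - c ≫ d`.
  let d : X ⟶ X ⊞ Q := biprod.lift u g
  let c : X ⊞ Q ⟶ X := biprod.desc v h
  have hdc : d ≫ c = 𝟙 X := by simp only [d, c, biprod.lift_desc, H]
  have hv : biprod.inl ≫ c = v := biprod.inl_desc _ _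
  have hh : biprod.inr ≫ c = h := biprod.inr_desc _ _
  have hu : d ≫ biprod.fst = u := biprod.lift_fst _ _
  have hk : (biprod.inl - v ≫ d) ≫ c = 0 := by
    rw [Preadditive.sub_comp, Category.assoc, hdc, hv, Category.comp_id, sub_self]
  have hn : (h ≫ d - biprod.inr) ≫ c = 0 := by
    rw [Preadditive.sub_comp, Category.assoc, hdc, hh, Category.comp_id, sub_self]
  have hι : kernel.ι c ≫ biprod.fst ≫ v + kernel.ι c ≫ biprod.snd ≫ h = 0 := by
    rw [← Preadditive.comp_add, ← biprod.desc_eq]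
    exact kernel.condition c
  have hid : kernel.ι c = (kernel.ι c ≫ biprod.fst) ≫ biprod.inl +
      (kernel.ι c ≫ biprod.snd) ≫ biprod.inr := by
    rw [Category.assoc, Category.assoc, ← Preadditive.comp_add, biprod.total, Category.comp_id]
  -- The lifts `k` and `n` are the components of `𝟙 - c ≫ d` on `X` and on `Q`, the latter with sign
  -- reversed, whence `j ≫ k - m ≫ n = 𝟙`.
  refine ⟨kernel c, kernel.lift c _ hk, kernel.ι c ≫ biprod.fst, kernel.ι c ≫ biprod.snd,
    kernel.lift c _ hn, ?_, ?_⟩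
  · rw [kernel.lift_ι_assoc, Preadditive.sub_comp, biprod.inl_fst, Category.assoc, hu]
  · rw [← cancel_mono (kernel.ι c), Preadditive.sub_comp, Category.assoc _ (kernel.lift _ _ _),
      Category.assoc _ (kernel.lift _ _ _), kernel.lift_ι, kernel.lift_ι, Category.id_comp,
      Preadditive.comp_sub, Preadditive.comp_sub]
    have hι' : (kernel.ι c ≫ biprod.fst) ≫ v ≫ d = -((kernel.ι c ≫ biprod.snd) ≫ h ≫ d) := by
      rw [eq_neg_iff_add_eq_zero]
      simpa only [Preadditive.add_comp, Category.assoc, zero_comp] using congrArg (· ≫ d) hι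
    rw [hι']
    rw [← sub_eq_of_eq_add' hid]
    abel

/-! ### Shifts on a countable copower. -/

section Shift

variable [HasCoproductsOfShape ℕ C] (X : C)

/-- The countable copower of an object. -/
noncomputable abbrev copower : C := ∐ fun _ : ℕ => X

/-- The endomorphism of the countable copower that shifts the summands to the right. -/
noncomputable def shiftRight : copower X ⟶ copower X :=
  Sigma.desc fun n => Sigma.ι (fun _ : ℕ => X) (n + 1)

/-- The endomorphism of the countable copower that shifts the summands to the left. -/
noncomputable def shiftLeft [Preadditive C] : copower X ⟶ copower X :=
  Sigma.desc fun n => Nat.casesOn n 0 fun m => Sigma.ι (fun _ : ℕ => X) m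

/-- The projection of the countable copower to its first summand. -/
noncomputable def projZero [Preadditive C] : copower X ⟶ X :=
  Sigma.desc fun n => Nat.casesOn n (𝟙 X) fun _ => 0

instance [Projective X] : Projective (copower X) where
  factors f e _ := ⟨Sigma.desc fun n => Projective.factorThru (Sigma.ι (fun _ : ℕ => X) n ≫ f) e,
    Sigma.hom_ext _ _ fun n => by rw [Sigma.ι_desc_assoc, Projective.factorThru_comp]⟩

lemma ι_shiftRight (n : ℕ) :
    Sigma.ι (fun _ : ℕ => X) n ≫ shiftRight X = Sigma.ι (fun _ : ℕ => X) (n + 1) :=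
  Sigma.ι_desc _ _

lemma ι_zero_shiftLeft [Preadditive C] : Sigma.ι (fun _ : ℕ => X) 0 ≫ shiftLeft X = 0 :=
  Sigma.ι_desc _ _

lemma ι_succ_shiftLeft [Preadditive C] (n : ℕ) :
    Sigma.ι (fun _ : ℕ => X) (n + 1) ≫ shiftLeft X = Sigma.ι (fun _ : ℕ => X) n :=
  Sigma.ι_desc _ _

lemma ι_zero_projZero [Preadditive C] : Sigma.ι (fun _ : ℕ => X) 0 ≫ projZero X = 𝟙 X :=
  Sigma.ι_desc _ _

lemma ι_succ_projZero [Preadditive C] (n : ℕ) : Sigma.ι (fun _ : ℕ => X) (n + 1) ≫ projZero X = 0 :=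
  Sigma.ι_desc _ _

lemma shiftRight_shiftLeft [Preadditive C] : shiftRight X ≫ shiftLeft X = 𝟙 _ := by
  refine Sigma.hom_ext _ _ fun n => ?_
  rw [← Category.assoc, ι_shiftRight, ι_succ_shiftLeft, Category.comp_id]

lemma shiftLeft_shiftRight [Preadditive C] :
    shiftLeft X ≫ shiftRight X = 𝟙 _ - projZero X ≫ Sigma.ι (fun _ : ℕ => X) 0 := by
  refine Sigma.hom_ext _ _ fun n => ?_
  rw [Preadditive.comp_sub, ← Category.assoc, ← Category.assoc, Category.comp_id]
  cases n with
  | zero => rw [ι_zero_shiftLeft, ι_zero_projZero, zero_comp, Category.id_comp, sub_self]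
  | succ n => rw [ι_succ_shiftLeft, ι_succ_projZero, ι_shiftRight, zero_comp, sub_zero]

variable {X} {Y : C} (f : X ⟶ Y)

/-- The morphism induced on countable copowers. -/
noncomputable abbrev copowerMap : copower X ⟶ copower Y :=
  Limits.Sigma.map fun _ : ℕ => f

lemma copowerMap_shiftRight :
    copowerMap f ≫ shiftRight Y = shiftRight X ≫ copowerMap f := by
  refine Sigma.hom_ext _ _ fun n => ?_
  rw [Sigma.ι_map_assoc, ι_shiftRight, ← Category.assoc, ι_shiftRight, Sigma.ι_map]

lemma copowerMap_shiftLeft [Preadditive C] :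
    copowerMap f ≫ shiftLeft Y = shiftLeft X ≫ copowerMap f := by
  refine Sigma.hom_ext _ _ fun n => ?_
  rw [Sigma.ι_map_assoc, ← Category.assoc _ (shiftLeft X)]
  cases n with
  | zero => rw [ι_zero_shiftLeft, ι_zero_shiftLeft, zero_comp, comp_zero]
  | succ n => rw [ι_succ_shiftLeft, ι_succ_shiftLeft, Sigma.ι_map]

lemma copowerMap_projZero [Preadditive C] : copowerMap f ≫ projZero Y = projZero X ≫ f := by
  refine Sigma.hom_ext _ _ fun n => ?_
  rw [Sigma.ι_map_assoc, ← Category.assoc _ (projZero X)]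
  cases n with
  | zero => rw [ι_zero_projZero, ι_zero_projZero, Category.comp_id, Category.id_comp]
  | succ n => rw [ι_succ_projZero, ι_succ_projZero, zero_comp, comp_zero]

end Shift

/-- In an abelian category with countable coproducts, idempotents split modulo morphisms that
factor through projectives. -/
theorem exists_stable_splitting [Abelian C] [HasExt.{w} C] [HasCoproductsOfShape ℕ C] {Z Q : C}
    [Projective Q] (a : Z ⟶ Z) (g : Z ⟶ Q) (h : Q ⟶ Z) (H : a - a ≫ a = g ≫ h) :
    ∃ (M : C) (p : Z ⟶ M) (q : M ⟶ Z), ExtNull (q ≫ p - 𝟙 M) ∧ ExtNull (p ≫ q - a) := by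
  let A := copowerMap a
  let S := shiftRight Z
  let T := shiftLeft Z
  let i := Sigma.ι (fun _ : ℕ => Z) 0
  let π := projZero Z
  let G := copowerMap g
  let K := copowerMap h
  have hG : A - A ≫ A = G ≫ K := by
    refine Sigma.hom_ext _ _ fun n => ?_
    simp only [A, G, K, Preadditive.comp_sub, Sigma.ι_map, Sigma.ι_map_assoc]
    rw [← Category.assoc g, ← H, Preadditive.sub_comp, Category.assoc]
  have hST : S ≫ T = 𝟙 _ := shiftRight_shiftLeft Z
  have hTS : T ≫ S = 𝟙 _ - π ≫ i := shiftLeft_shiftRight Z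
  have hAS : A ≫ S = S ≫ A := copowerMap_shiftRight a
  have hAT : A ≫ T = T ≫ A := copowerMap_shiftLeft a
  have hiA : i ≫ A = a ≫ i := Sigma.ι_map _ _
  have hAπ : A ≫ π = π ≫ a := copowerMap_projZero a
  -- Stably, `u` shifts the image of `A` and is the identity on the complementary part; `v` shifts
  -- back. So `u` is a split mono whose cokernel is one copy of the image of `a`.
  let u := A ≫ S + (𝟙 _ - A)
  let v := A ≫ T + (𝟙 _ - A)
  have hGK {V : C} (x : copower Z ⟶ V) : G ≫ K ≫ x = A ≫ x - A ≫ A ≫ x := by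
    rw [← Category.assoc, ← hG, Preadditive.sub_comp, Category.assoc]
  have hAS' {V : C} (x : copower Z ⟶ V) : S ≫ A ≫ x = A ≫ S ≫ x := by
    rw [← Category.assoc, ← hAS, Category.assoc]
  have hAT' {V : C} (x : copower Z ⟶ V) : T ≫ A ≫ x = A ≫ T ≫ x := by
    rw [← Category.assoc, ← hAT, Category.assoc]
  -- Expanding `u ≫ v` with `S ≫ T = 𝟙` leaves the error `(A - A ≫ A) ≫ (𝟙 + 𝟙 - S - T)`, which
  -- factors through the projective copower of `Q`.
  have huv : u ≫ v + G ≫ K ≫ (𝟙 _ + 𝟙 _ - S - T) = 𝟙 _ := by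
    rw [hGK]
    simp only [u, v, Preadditive.comp_add, Preadditive.add_comp, Preadditive.comp_sub,
      Preadditive.sub_comp, Category.assoc, Category.comp_id, Category.id_comp, hAS', ← hAS, hST]
    abel
  -- The same expansion in the other order, except that `T ≫ S` misses the zeroth summand: this
  -- yields the extra term `A ≫ A ≫ π ≫ i`, stably `a` placed on that summand.
  have hvu : 𝟙 _ - v ≫ u = G ≫ K ≫ (𝟙 _ + 𝟙 _ - S - T) + A ≫ A ≫ π ≫ i := by
    rw [hGK]
    simp only [u, v, Preadditive.comp_add, Preadditive.add_comp, Preadditive.comp_sub,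
      Preadditive.sub_comp, Category.assoc, Category.comp_id, Category.id_comp, hAT', ← hAT, hTS]
    abel
  obtain ⟨M, k, j, m, n, hkj, hjk⟩ := exists_complement u v G _ huv
  have hG₀ : ExtNull G := extNull_of_projective G
  have hjk₀ : ExtNull (j ≫ k - 𝟙 M) := hjk ▸ (extNull_of_projective m).comp_right n
  have hkj₀ : ExtNull (k ≫ j - A ≫ A ≫ π ≫ i) := by
    rw [hkj, hvu, add_sub_cancel_right]
    exact hG₀.comp_right _
  have ha : ExtNull (a - a ≫ a) := H ▸ (extNull_of_projective g).comp_right h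
  refine ⟨M, a ≫ i ≫ k, j ≫ π ≫ a, ?_, ?_⟩
  · have e : (j ≫ π ≫ a) ≫ a ≫ i ≫ k - 𝟙 M = (j ≫ k - 𝟙 M) + (j ≫ k - 𝟙 M) ≫ j ≫ k
        - j ≫ (k ≫ j - A ≫ A ≫ π ≫ i) ≫ k := by
      have hAAπ {V : C} (x : Z ⟶ V) : A ≫ A ≫ π ≫ x = π ≫ a ≫ a ≫ x := by
        rw [← Category.assoc A π, hAπ, Category.assoc, ← Category.assoc A π, hAπ, Category.assoc]
      simp only [Preadditive.comp_sub, Preadditive.sub_comp, Category.assoc, Category.id_comp,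
        hAAπ]
      abel
    rw [e]
    exact (hjk₀.add (hjk₀.comp_right _)).sub ((hkj₀.comp_right k).comp_left j)
  · have e : (a ≫ i ≫ k) ≫ j ≫ π ≫ a - a = (a ≫ i) ≫ (k ≫ j - A ≫ A ≫ π ≫ i) ≫ π ≫ a
        - ((a - a ≫ a) + (a - a ≫ a) ≫ a + (a - a ≫ a) ≫ a ≫ a) := by
      have hiπ {V : C} (x : Z ⟶ V) : i ≫ π ≫ x = x := by
        rw [← Category.assoc, ι_zero_projZero, Category.id_comp]
      have hiA' {V : C} (x : copower Z ⟶ V) : i ≫ A ≫ x = a ≫ i ≫ x := by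
        rw [← Category.assoc, hiA, Category.assoc]
      simp only [Preadditive.comp_sub, Preadditive.sub_comp, Category.assoc, hiπ, hiA']
      abel
    rw [e]
    exact ((hkj₀.comp_right _).comp_left _).sub
      ((ha.add (ha.comp_right _)).add (ha.comp_right _))

end StableIdempotents

/-! ### Presentations by a generator and relations. -/

section Presentations

universe v' u'

variable {C : Type u'} [Category.{v'} C]

/-- `x ∈ F(X)` generates `F`, and its relations are the morphisms that factor through `f`. -/
structure IsPresentedBy [Preadditive C] (F : C ⥤ AddCommGrpCat.{v'}) {X Y : C} (f : X ⟶ Y)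
    (x : F.obj X) : Prop where
  exists_map_eq : ∀ ⦃W : C⦄ (y : F.obj W), ∃ h : X ⟶ W, F.map h x = y
  map_eq_zero_iff : ∀ ⦃W : C⦄ (h : X ⟶ W), F.map h x = 0 ↔ ∃ g : Y ⟶ W, f ≫ g = h

section Preadditive

variable [Preadditive C]

/-- By the Yoneda lemma, `f` is the image of `𝟙 Y` under `α` and the generator is the image of `𝟙 X`
in the cokernel; exactness is then checked objectwise. -/
lemma exists_isPresentedBy {F : C ⥤ AddCommGrpCat.{v'}} {X Y : C}
    (α : preadditiveCoyoneda.obj (Opposite.op Y) ⟶ preadditiveCoyoneda.obj (Opposite.op X))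
    (e : F ≅ cokernel α) : ∃ (f : X ⟶ Y) (x : F.obj X), IsPresentedBy F f x := by
  let p : preadditiveCoyoneda.obj (Opposite.op X) ⟶ F := cokernel.π α ≫ e.inv
  let f : X ⟶ Y := α.app Y (𝟙 Y)
  have hα {W : C} (g : Y ⟶ W) : α.app W g = f ≫ g := by
    have := ConcreteCategory.congr_hom (α.naturality g) (𝟙 Y)
    change α.app W (𝟙 Y ≫ g) = f ≫ g at this
    rwa [Category.id_comp] at this
  have hp {W : C} (h : X ⟶ W) : F.map h (p.app X (𝟙 X)) = p.app W h := by
    have := ConcreteCategory.congr_hom (p.naturality h) (𝟙 X)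
    change p.app W (𝟙 X ≫ h) = F.map h (p.app X (𝟙 X)) at this
    rw [← this, Category.id_comp]
  have hzero : α ≫ p = 0 := by rw [cokernel.condition_assoc, zero_comp]
  have hexact : (ShortComplex.mk α p hzero).Exact :=
    ShortComplex.exact_of_g_is_cokernel _
      (IsColimit.ofIsoColimit (cokernelIsCokernel α) (Cofork.ext e.symm rfl))
  have hepi (W : C) : Epi (p.app W) := inferInstance
  refine ⟨f, p.app X (𝟙 X), fun W y => ?_, fun W h => ?_⟩
  · obtain ⟨h, hh⟩ := (AddCommGrpCat.epi_iff_surjective _).1 (hepi W) y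
    exact ⟨h, (hp h).trans hh⟩
  · rw [hp]
    constructor
    · intro hh
      have := hexact.map ((evaluation C AddCommGrpCat.{v'}).obj W)
      rw [ShortComplex.ab_exact_iff] at this
      obtain ⟨g, hg⟩ := this h hh
      exact ⟨g, (hα g).symm.trans hg⟩
    · rintro ⟨g, rfl⟩
      rw [← hα]
      exact ConcreteCategory.congr_hom (NatTrans.congr_app hzero W) g

variable {F G : C ⥤ AddCommGrpCat.{v'}} [F.Additive] [G.Additive] {X Y : C} {f : X ⟶ Y}
  {x : F.obj X} {y : G.obj X}

lemma map_add_apply (F : C ⥤ AddCommGrpCat.{v'}) [F.Additive] {X W : C} (g h : X ⟶ W)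
    (x : F.obj X) : F.map (g + h) x = F.map g x + F.map h x := by
  rw [F.map_add]; rfl

lemma map_sub_apply (F : C ⥤ AddCommGrpCat.{v'}) [F.Additive] {X W : C} (g h : X ⟶ W)
    (x : F.obj X) : F.map (g - h) x = F.map g x - F.map h x := by
  rw [F.map_sub]; rfl

lemma IsPresentedBy.map_eq_map_iff (hF : IsPresentedBy F f x) (hG : IsPresentedBy G f y) {W : C}
    (g h : X ⟶ W) : F.map g x = F.map h x ↔ G.map g y = G.map h y := by
  rw [← sub_eq_zero, ← map_sub_apply, hF.map_eq_zero_iff, ← hG.map_eq_zero_iff, map_sub_apply,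
    sub_eq_zero]

/-- Functors with the same presentation are isomorphic. -/
lemma IsPresentedBy.nonempty_iso (hF : IsPresentedBy F f x) (hG : IsPresentedBy G f y) :
    Nonempty (F ≅ G) := by
  -- The isomorphism sends `F.map h x` to `G.map h y`. The choice of `h` is harmless since both
  -- functors have the same relations.
  choose s hs using hF.exists_map_eq
  have key {W : C} (h : X ⟶ W) : G.map (s (F.map h x)) y = G.map h y :=
    (hF.map_eq_map_iff hG _ _).1 (hs _)
  let φ : F ⟶ G :=
    { app := fun W => AddCommGrpCat.ofHom (AddMonoidHom.mk' (fun z => G.map (s z) y) fun z z' => by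
        obtain ⟨h, rfl⟩ := hF.exists_map_eq z
        obtain ⟨h', rfl⟩ := hF.exists_map_eq z'
        rw [← map_add_apply, key, key, key, map_add_apply])
      naturality := fun W W' g => by
        ext z
        obtain ⟨h, rfl⟩ := hF.exists_map_eq z
        change G.map (s (F.map g (F.map h x))) y = G.map g (G.map (s (F.map h x)) y)
        rw [← ConcreteCategory.comp_apply, ← F.map_comp, key, key, G.map_comp,
          ConcreteCategory.comp_apply] }
  have hφ (W : C) : Function.Bijective (φ.app W) := by
    constructor
    · intro z z' hz
      have : F.map (s z) x = F.map (s z') x := (hF.map_eq_map_iff hG _ _).2 hz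
      rwa [hs, hs] at this
    · intro z
      obtain ⟨h, rfl⟩ := hG.exists_map_eq z
      exact ⟨F.map h x, key h⟩
  have (W : C) : IsIso (φ.app W) := (ConcreteCategory.isIso_iff_bijective _).2 (hφ W)
  exact ⟨NatIso.ofComponents (fun W => asIso (φ.app W)) fun g => φ.naturality g⟩

end Preadditive

variable [Abelian C]

/-- A morphism of short exact sequences from `S` to `T` that is an isomorphism on `X₃` gives
rise to a short exact sequence `0 ⟶ S.X₁ ⟶ T.X₁ ⊞ S.X₂ ⟶ T.X₂ ⟶ 0`. -/
lemma shortExact_of_morphism {S T : ShortComplex C} (hS : S.ShortExact) (hT : T.ShortExact)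
    (φ : S ⟶ T) [IsIso φ.τ₃] :
    (ShortComplex.mk (biprod.lift φ.τ₁ (-S.f)) (biprod.desc T.f φ.τ₂) (by
      rw [biprod.lift_desc, φ.comm₁₂, Preadditive.neg_comp, add_neg_cancel])).ShortExact := by
  have := hS.mono_f
  have := hS.epi_g
  have := hT.mono_f
  have := hT.epi_g
  have hmono : Mono (biprod.lift φ.τ₁ (-S.f)) := by
    have : Mono (biprod.lift φ.τ₁ (-S.f) ≫ biprod.snd) := by
      rw [biprod.lift_snd]; infer_instance
    exact mono_of_mono _ biprod.snd
  have hepi : Epi (biprod.desc T.f φ.τ₂) := by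
    refine Preadditive.epi_of_cancel_zero _ fun {A} h hh => ?_
    have h₁ : T.f ≫ h = 0 := by rw [← biprod.inl_desc_assoc T.f φ.τ₂, hh, comp_zero]
    have h₂ : φ.τ₂ ≫ h = 0 := by rw [← biprod.inr_desc_assoc T.f φ.τ₂, hh, comp_zero]
    -- A morphism killing `T.f` descends to `T.X₃`; as `φ.τ₃` and `S.g` are epi, it is tested on
    -- `S.X₂`, where it vanishes.
    have h₃ : hT.exact.desc h h₁ = 0 := by
      rw [← cancel_epi φ.τ₃, ← cancel_epi S.g, comp_zero, comp_zero, ← φ.comm₂₃_assoc,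
        hT.exact.g_desc, h₂]
    rw [← hT.exact.g_desc h h₁, h₃, comp_zero]
  have hlift {A : C} (k : A ⟶ T.X₁ ⊞ S.X₂) (hk : k ≫ biprod.desc T.f φ.τ₂ = 0) :
      ∃ l : A ⟶ S.X₁, l ≫ biprod.lift φ.τ₁ (-S.f) = k := by
    have hk' : (-(k ≫ biprod.snd)) ≫ φ.τ₂ = (k ≫ biprod.fst) ≫ T.f := by
      rw [Preadditive.neg_comp, neg_eq_iff_add_eq_zero, ← hk, biprod.desc_eq,
        Preadditive.comp_add, Category.assoc, Category.assoc, add_comm]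
    have h₀ : (-(k ≫ biprod.snd)) ≫ S.g = 0 := by
      rw [← cancel_mono φ.τ₃, zero_comp, Category.assoc, ← φ.comm₂₃, ← Category.assoc, hk',
        Category.assoc, T.zero, comp_zero]
    refine ⟨hS.exact.lift _ h₀, biprod.hom_ext _ _ ?_ ?_⟩
    · rw [Category.assoc, biprod.lift_fst, ← cancel_mono T.f, Category.assoc, φ.comm₁₂,
        hS.exact.lift_f_assoc, hk']
    · rw [Category.assoc, biprod.lift_snd, Preadditive.comp_neg, hS.exact.lift_f, neg_neg]
  exact ⟨ShortComplex.exact_of_f_is_kernel _ (KernelFork.IsLimit.ofι' _ _ fun k hk =>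
    ⟨(hlift k hk).choose, (hlift k hk).choose_spec⟩)⟩

end Presentations

/-! ### From half exactness to extension functors. -/

section ExtensionFunctors

universe v' u'

variable {C : Type u'} [Category.{v'} C] [Abelian C]

/-- The cosyzygy sequence of an injective splits, and an additive functor preserves the splitting.
-/
lemma isZero_rightObj_of_injective [EnoughInjectives C] {D : Type*} [Category D] [Abelian D]
    (F : C ⥤ D) [F.Additive] (I : C) [Injective I] : IsZero (rightObj F I) := by
  have := (cosyz_shortExact I).mono_f
  have := (cosyz_shortExact I).epi_g
  have : Epi (F.map (cosyz I).g) :=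
    (((cosyz_shortExact I).splittingOfInjective.map F).epi_g :)
  exact isZero_cokernel_of_epi _

/-- The source of the counit is `S¹` of the functor `S¹S₂F`, so it vanishes on injectives. -/
lemma IsHorizontallyLinked.isZero_of_injective [EnoughInjectives C] [EnoughProjectives C]
    {D : Type*} [Category D] [Abelian D] {F : C ⥤+ D} (hF : IsHorizontallyLinked F) (I : C)
    [Injective I] : IsZero (F.obj.obj I) := by
  have : IsIso ((adj₂ C D).counit.app F) := hF
  let e := (AdditiveFunctor.forget C D).mapIso (asIso ((adj₂ C D).counit.app F))
  exact (isZero_rightObj_of_injective _ I).of_iso (e.app I).symm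

lemma exists_extClass_comp_eq [HasExt.{v'} C] {S : ShortComplex C} (hS : S.ShortExact)
    [Projective S.X₂] {W : C} (ξ : Ext S.X₃ W 1) :
    ∃ h : S.X₁ ⟶ W, hS.extClass.comp (Ext.mk₀ h) (add_zero 1) = ξ := by
  obtain ⟨h, hh⟩ := Ext.contravariant_sequence_exact₃ hS W ξ (Ext.eq_zero_of_projective _)
    (add_zero 1)
  obtain ⟨h, rfl⟩ := (Ext.mk₀_bijective _ _).2 h
  exact ⟨h, hh⟩

variable [EnoughProjectives C] {F : C ⥤+ AddCommGrpCat.{v'}}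

/-- If a half exact functor is presented by a monomorphism `X₁ ⟶ X₂`, then every morphism
`φ` from the syzygy sequence of `X₃ = X₂/X₁` lifting an isomorphism has a right inverse up to
homotopy, in the sense that `a ≫ φ` is homotopic to the identity on `X₁`. -/
lemma exists_syzygy_endomorphism (hF : IsHalfExact F) {S : ShortComplex C} (hS : S.ShortExact)
    {x : F.obj.obj S.X₁} (hx : IsPresentedBy F.obj S.f x) (φ : syz S.X₃ ⟶ S) [IsIso φ.τ₃] :
    ∃ (a : S ⟶ syz S.X₃) (g : S.X₂ ⟶ S.X₁), a.τ₁ ≫ φ.τ₁ - 𝟙 _ = S.f ≫ g := by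
  have := hS.epi_g
  have hE := hF _ (shortExact_of_morphism (syz_shortExact _) hS φ)
  have := F.property
  rw [ShortComplex.ab_exact_iff] at hE
  have hfx : F.obj.map S.f x = 0 := (hx.map_eq_zero_iff _).2 ⟨𝟙 _, Category.comp_id _⟩
  -- The element `(x, 0)` of `F(X₁ ⊞ P)` dies in `F(X₂)`, so it comes from some `z ∈ F(ΩX₃)`, and
  -- `z` is the image of `x` under some `a₁ : X₁ ⟶ ΩX₃`.
  obtain ⟨z, hz⟩ := hE (F.obj.map biprod.inl x) (by
    change F.obj.map (biprod.desc S.f φ.τ₂) (F.obj.map biprod.inl x) = 0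
    rw [← ConcreteCategory.comp_apply, ← F.obj.map_comp, biprod.inl_desc, hfx])
  obtain ⟨a₁, rfl⟩ := hx.exists_map_eq z
  change F.obj.map (biprod.lift φ.τ₁ (-(syz S.X₃).f)) (F.obj.map a₁ x) = _ at hz
  rw [← ConcreteCategory.comp_apply, ← F.obj.map_comp, ← sub_eq_zero, ← map_sub_apply,
    hx.map_eq_zero_iff] at hz
  -- The relation `t : X₂ ⟶ X₁ ⊞ P` has two uses: its first component is the homotopy, and minus its
  -- second extends `a₁` to a morphism of short exact sequences.
  obtain ⟨t, ht⟩ := hz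
  have hfst : S.f ≫ t ≫ biprod.fst = a₁ ≫ φ.τ₁ - 𝟙 _ := by
    rw [← Category.assoc, ht, Preadditive.sub_comp, Category.assoc, biprod.lift_fst,
      biprod.inl_fst]
  have hsnd : a₁ ≫ (syz S.X₃).f = S.f ≫ (-(t ≫ biprod.snd)) := by
    rw [Preadditive.comp_neg, ← Category.assoc, ht, Preadditive.sub_comp, Category.assoc,
      biprod.lift_snd, biprod.inl_snd, sub_zero, Preadditive.comp_neg, neg_neg]
  have h₀ : S.f ≫ (-(t ≫ biprod.snd)) ≫ (syz S.X₃).g = 0 := by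
    rw [← Category.assoc, ← hsnd, Category.assoc, (syz S.X₃).zero, comp_zero]
  exact ⟨⟨a₁, -(t ≫ biprod.snd), hS.exact.desc _ h₀, hsnd, (hS.exact.g_desc _ h₀).symm⟩,
    t ≫ biprod.fst, hfst.symm⟩

/-- A half exact functor presented by a monomorphism is an extension functor. -/
theorem exists_iso_extFunctorObj [HasCoproductsOfShape ℕ C] [HasExt.{v'} C] (hF : IsHalfExact F)
    {S : ShortComplex C} (hS : S.ShortExact) {x : F.obj.obj S.X₁}
    (hx : IsPresentedBy F.obj S.f x) : ∃ M : C, Nonempty (F.obj ≅ extFunctorObj M 1) := by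
  have := F.property
  obtain ⟨s, w, hw, hs⟩ := exists_coconn hS (𝟙 S.X₃)
  let φ : syz S.X₃ ⟶ S := ⟨s, w, 𝟙 _, hs, hw⟩
  have : IsIso φ.τ₃ := inferInstanceAs (IsIso (𝟙 _))
  obtain ⟨a, g, hg⟩ := exists_syzygy_endomorphism hF hS hx φ
  let Z := S.X₃
  let η : Ext Z S.X₁ 1 := hS.extClass
  let ε : Ext Z (syz Z).X₁ 1 := (syz_shortExact Z).extClass
  have hεη : ε.comp (Ext.mk₀ s) (add_zero 1) = η :=
    ((syz_shortExact Z).extClass_naturality hS φ).trans (Ext.mk₀_id_comp _)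
  have hηε : η.comp (Ext.mk₀ a.τ₁) (add_zero 1) = (Ext.mk₀ a.τ₃).comp ε (zero_add 1) :=
    hS.extClass_naturality (syz_shortExact Z) a
  have hη_f {W : C} (h : S.X₂ ⟶ W) : η.comp (Ext.mk₀ (S.f ≫ h)) (add_zero 1) = 0 := by
    rw [← Ext.mk₀_comp_mk₀, hS.extClass_comp_assoc]
  have hηas : η.comp (Ext.mk₀ (a.τ₁ ≫ s)) (add_zero 1) = η := by
    rw [show a.τ₁ ≫ s = 𝟙 _ + S.f ≫ g from (sub_eq_iff_eq_add'.1 hg), Ext.mk₀_add, Ext.comp_add,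
      hη_f, add_zero, Ext.comp_mk₀_id]
  have : Projective (syz Z).X₂ := inferInstanceAs (Projective (Projective.over Z))
  have ha {W : C} (h : (syz Z).X₁ ⟶ W) :
      (Ext.mk₀ a.τ₃).comp (ε.comp (Ext.mk₀ h) (add_zero 1)) (zero_add 1) =
        η.comp (Ext.mk₀ (a.τ₁ ≫ h)) (add_zero 1) := by
    rw [← Ext.comp_assoc_of_third_deg_zero, ← hηε, Ext.comp_assoc_of_third_deg_zero,
      Ext.mk₀_comp_mk₀]
  -- `a.τ₃` fixes the multiples of `η`, while by `ha_range` its action lands in them: it acts as a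
  -- projection of `Ext¹(Z, -)` onto `F`.
  have ha_mul {W : C} (h : S.X₁ ⟶ W) :
      (Ext.mk₀ a.τ₃).comp (η.comp (Ext.mk₀ h) (add_zero 1)) (zero_add 1) =
        η.comp (Ext.mk₀ h) (add_zero 1) := by
    rw [← hεη, Ext.comp_assoc_of_third_deg_zero, Ext.mk₀_comp_mk₀, ha, ← Category.assoc,
      ← Ext.mk₀_comp_mk₀, ← Ext.comp_assoc_of_third_deg_zero, hηas,
      ← Ext.mk₀_comp_mk₀ s, ← Ext.comp_assoc_of_third_deg_zero, hεη]
  have ha_range {W : C} (ξ : Ext Z W 1) : ∃ h : S.X₁ ⟶ W,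
      (Ext.mk₀ a.τ₃).comp ξ (zero_add 1) = η.comp (Ext.mk₀ h) (add_zero 1) := by
    obtain ⟨h, rfl⟩ := exists_extClass_comp_eq (syz_shortExact Z) ξ
    exact ⟨_, ha h⟩
  -- `a.τ₃ - a.τ₃ ≫ a.τ₃` annihilates the syzygy class `ε`, hence lifts along the projective cover
  -- term `(syz Z).X₂ ⟶ Z`.
  obtain ⟨b, hb⟩ : ∃ b : Z ⟶ (syz Z).X₂, a.τ₃ - a.τ₃ ≫ a.τ₃ = b ≫ (syz Z).g := by
    have h₀ : (Ext.mk₀ (a.τ₃ - a.τ₃ ≫ a.τ₃)).comp ε (zero_add 1) = 0 := by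
      rw [sub_eq_add_neg, Ext.mk₀_add, Ext.mk₀_neg, Ext.add_comp, Ext.neg_comp,
        ← Ext.mk₀_comp_mk₀_assoc, ← hηε, ha_mul, add_neg_cancel]
    obtain ⟨b, hb⟩ := Ext.covariant_sequence_exact₃ Z (syz_shortExact Z) _ _ h₀
    obtain ⟨b, rfl⟩ := (Ext.mk₀_bijective _ _).2 b
    rw [Ext.mk₀_comp_mk₀] at hb
    exact ⟨b, ((Ext.mk₀_bijective _ _).1 hb).symm⟩
  obtain ⟨M, p, q, hqp, hpq⟩ := exists_stable_splitting a.τ₃ b (syz Z).g hb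
  -- Precomposition with `p` identifies `Ext¹(M, -)` with the image of `a.τ₃`, with inverse given by
  -- `q`; so the generator `η` corresponds to its pullback along `q`.
  refine ⟨M, hx.nonempty_iso (y := (Ext.mk₀ q).comp η (zero_add 1)) ⟨fun W ξ => ?_, fun W h => ?_⟩⟩
  · obtain ⟨h, hh⟩ := ha_range ((Ext.mk₀ p).comp ξ (zero_add 1))
    refine ⟨h, ?_⟩
    change ((Ext.mk₀ q).comp η (zero_add 1)).comp (Ext.mk₀ h) (add_zero 1) = ξ
    have hqp' (ζ : Ext M W 1) :
        (Ext.mk₀ q).comp ((Ext.mk₀ p).comp ζ (zero_add 1)) (zero_add 1) = ζ := by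
      rw [Ext.mk₀_comp_mk₀_assoc, hqp.comp_eq, Ext.mk₀_id_comp]
    rw [Ext.comp_assoc_of_third_deg_zero, ← hh, ← hpq.comp_eq, ← Ext.mk₀_comp_mk₀_assoc, hqp']
    exact hqp' ξ
  · change ((Ext.mk₀ q).comp η (zero_add 1)).comp (Ext.mk₀ h) (add_zero 1) = 0 ↔ _
    rw [Ext.comp_assoc_of_third_deg_zero]
    constructor
    · intro hh
      -- Pulling back along `p` recovers `η ≫ h`, because `p ≫ q` acts as `a.τ₃`, which fixes it.
      have h₀ : η.comp (Ext.mk₀ h) (add_zero 1) = 0 := by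
        rw [← ha_mul, ← hpq.comp_eq, ← Ext.mk₀_comp_mk₀_assoc, hh, Ext.comp_zero]
      obtain ⟨g', hg'⟩ := Ext.contravariant_sequence_exact₁ hS W _ _ h₀
      obtain ⟨g', rfl⟩ := (Ext.mk₀_bijective _ _).2 g'
      rw [Ext.mk₀_comp_mk₀] at hg'
      exact ⟨g', (Ext.mk₀_bijective _ _).1 hg'⟩
    · rintro ⟨g', rfl⟩
      rw [hη_f, Ext.comp_zero]

end ExtensionFunctors

end Satellite

theorem mainTheorem8 {R : Type u} [Ring R] (hR : Satellite.IsCoherent R)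
    (F : ModuleCat.{u} Rᵐᵒᵖ ⥤+ AddCommGrpCat.{u})
    (hF : Satellite.IsTotallyFinitelyPresented F)
    (hhalf : Satellite.IsHalfExact F)
    (hlinked : Satellite.IsHorizontallyLinked F) :
    Satellite.IsExtensionFunctor F := by
  obtain ⟨X, Y, α, -, -, ⟨e⟩⟩ := hF
  obtain ⟨f, x, hx⟩ := Satellite.exists_isPresentedBy α e
  have : Mono f := by
    have h₀ := hlinked.isZero_of_injective (Injective.under X)
    have := AddCommGrpCat.subsingleton_of_isZero h₀
    -- Vanishing of `F` on the injective `Injective.under X` makes `Injective.ι X` a relation, so it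
    -- factors through `f`.
    obtain ⟨g, hg⟩ := (hx.map_eq_zero_iff (Injective.ι X)).1 (Subsingleton.elim _ _)
    exact mono_of_mono_fac hg
  exact Satellite.exists_iso_extFunctorObj hhalf
    (S := ShortComplex.mk f (cokernel.π f) (cokernel.condition f))
    { exact := ShortComplex.exact_cokernel f } hx
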